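/- All Hilbert spaces are finite-dimensional and nonzero, and logarithms are binary. For a density operator $\rho$, a positive semi-definite operator $\sigma$ and $s\in[0,1)$ let $$D_s(\rho\Vert\sigma)=\frac{1}{s-1}\log_2\operatorname{Tr}\{\rho^{s}\sigma^{1-s}\}$$ (powers are taken on supports, so $\rho^0$ is the projection onto the support of $\rho$, and $-\log_2 0=+\infty$), and let $D_1(\rho\Vert\sigma)=D(\rho\Vert\sigma)$ be the quantum relative entropy $\operatorname{Tr}\{\rho[\log_2\rho-\log_2\sigma]\}$ (equal to $+\infty$ unless $\operatorname{supp}\rho\subseteq\operatorname{supp}\sigma$). For a bipartite state $\omega_{RB}$ the Rényi mutual information is $I_s(R;B)_\omega=D_s(\omega_{RB}\Vert\omega_R\otimes\omega_B)$. Let $\mathcal N_{A'\to B}$ be a quantum channel (a completely positive trace-preserving map). An $(M,\varepsilon)$ entanglement-assisted classical code for $\mathcal N$ consists of a shared state $\Psi_{RA}$ on systems $R$, $A$ of any finite dimensions, encoding channels $\mathcal E^m_{A\to A'}$ for $m=1,\dots,M$, and a decoding POVM $\{\Lambda^m_{RB}\}_{m=1}^M$ such that $$\frac1M\sum_{m=1}^M\operatorname{Tr}\{(I-\Lambda^m_{RB})\,\mathcal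 N_{A'\to B}(\mathcal E^m_{A\to A'}(\Psi_{RA}))\}\le\varepsilon .$$ Let $\varepsilon^*(\mathcal N,M)$ be the infimum of all $\varepsilon\in[0,1]$ for which an $(M,\varepsilon)$ code exists, and for $R\ge 0$ define the entanglement-assisted error exponent $$E_{\mathrm{EA}}(\mathcal N,R)=\limsup_{n\to\infty}\left[-\frac1n\log_2\varepsilon^*\!\left(\mathcal N^{\otimes n},\lceil 2^{nR}\rceil\right)\right]\in[0,+\infty].$$ **Proposition.** For every quantum channel $\mathcal N_{A'\to B}$ and every rate $R\ge0$, $$E_{\mathrm{EA}}(\mathcal N,R)\ \ge\ \sup_{s\in[0,1]}(1-s)\left[\sup_{\theta_{RA'}}I_s(R;B)_{\mathcal N(\theta)}-R\right],$$ where the inner supremum is over all pure bipartite states $\theta_{RA'}$ with $R$ of arbitrary finite dimension and $\mathcal N(\theta)$ denotes $(\mathrm{id}_R\otimes\mathcal N_{A'\to B})(\theta_{RA'})$. -/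

import Mathlib

open scoped Kronecker ComplexOrder

namespace EACode

noncomputable section

universe u v w

/-! ### States, channels, tensor products (finite-dimensional systems)

A system with Hilbert space `ℂ^a` is given by a finite index type `a` (an orthonormal basis);
operators on it are matrices `Matrix a a ℂ`, and the joint system of `r` and `a` is `r × a`. -/

/-- Density operators: positive semidefinite with unit trace. -/
def IsDensity {a : Type u} [Fintype a] (ρ : Matrix a a ℂ) : Prop :=
  ρ.PosSemidef ∧ ρ.trace = 1

/-- The rank-one operator `|ψ⟩⟨ψ|`. -/
def ketbra {a : Type u} (ψ : a → ℂ) : Matrix a a ℂ :=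
  Matrix.vecMulVec ψ (star ψ)

/-- `Tr_B X` for an operator `X` on `R ⊗ B`. -/
def traceRight {r : Type u} {b : Type v} [Fintype b] (X : Matrix (r × b) (r × b) ℂ) :
    Matrix r r ℂ :=
  Matrix.of fun i j => ∑ k, X (i, k) (j, k)

/-- `Tr_R X` for an operator `X` on `R ⊗ B`. -/
def traceLeft {r : Type u} {b : Type v} [Fintype r] (X : Matrix (r × b) (r × b) ℂ) :
    Matrix b b ℂ :=
  Matrix.of fun i j => ∑ k, X (k, i) (k, j)

/-- `(id_R ⊗ Φ)(X)` for an operator `X` on `R ⊗ A`: `Φ` acts on each block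
`⟨i|_R X |j⟩_R` of `X`. -/
def idTensor {r : Type w} {a : Type u} {b : Type v}
    (Φ : Matrix a a ℂ →ₗ[ℂ] Matrix b b ℂ) (X : Matrix (r × a) (r × a) ℂ) :
    Matrix (r × b) (r × b) ℂ :=
  Matrix.of fun p q => Φ (Matrix.of fun i j => X (p.1, i) (q.1, j)) p.2 q.2

/-- Quantum channels: completely positive and trace-preserving linear maps. -/
structure IsChannel {a : Type u} {b : Type v} [Fintype a] [Fintype b]
    (Φ : Matrix a a ℂ →ₗ[ℂ] Matrix b b ℂ) : Prop where
  trace_preserving : ∀ X : Matrix a a ℂ, (Φ X).trace = X.trace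
  completely_positive : ∀ (k : ℕ) (X : Matrix (Fin k × a) (Fin k × a) ℂ),
    X.PosSemidef → (idTensor Φ X).PosSemidef

/-- The `n`-fold tensor power `Φ^{⊗ n}`: the linear map which sends the matrix unit
`|x₁⟩⟨x'₁| ⊗ ⋯ ⊗ |xₙ⟩⟨x'ₙ|` to `Φ(|x₁⟩⟨x'₁|) ⊗ ⋯ ⊗ Φ(|xₙ⟩⟨x'ₙ|)`. -/
def tensorPow {a : Type u} {b : Type v} [Fintype a] [DecidableEq a]
    (Φ : Matrix a a ℂ →ₗ[ℂ] Matrix b b ℂ) (n : ℕ) :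
    Matrix (Fin n → a) (Fin n → a) ℂ →ₗ[ℂ] Matrix (Fin n → b) (Fin n → b) ℂ where
  toFun X := Matrix.of fun y y' =>
    ∑ x : Fin n → a, ∑ x' : Fin n → a,
      X x x' * ∏ k, Φ (Matrix.single (x k) (x' k) 1) (y k) (y' k)
  map_add' X Y := by
    ext y y'
    simp [add_mul, Finset.sum_add_distrib]
  map_smul' c X := by
    ext y y'
    simp [Finset.mul_sum, mul_assoc]

/-! ### Rényi relative entropy and Rényi mutual information -/

/-- The power `A ^ p` of a positive semidefinite operator, taken on the support of `A`
(so `A ^ 0` is the projection onto the support, and negative powers are generalized inverses). -/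
def suppPow {a : Type u} [Fintype a] [DecidableEq a] (A : Matrix a a ℂ) (p : ℝ) :
    Matrix a a ℂ :=
  cfc (fun x : ℝ => if x = 0 then 0 else x ^ p) A

/-- `supp ρ ⊆ supp σ` for Hermitian operators, i.e. `ker σ ⊆ ker ρ`. -/
def SuppLE {a : Type u} [Fintype a] (ρ σ : Matrix a a ℂ) : Prop :=
  ∀ v : a → ℂ, σ.mulVec v = 0 → ρ.mulVec v = 0

open Classical in
/-- Quantum relative entropy (binary logarithms; logarithms are taken on supports). -/
def relEntropy {a : Type u} [Fintype a] [DecidableEq a] (ρ σ : Matrix a a ℂ) : EReal :=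
  if SuppLE ρ σ then
    (((ρ * (cfc (Real.logb 2) ρ - cfc (Real.logb 2) σ)).trace.re : ℝ) : EReal)
  else ⊤

/-- `Tr {ρ^α σ^(1-α)}`. -/
def renyiTrace {a : Type u} [Fintype a] [DecidableEq a] (α : ℝ) (ρ σ : Matrix a a ℂ) : ℝ :=
  (suppPow ρ α * suppPow σ (1 - α)).trace.re

open Classical in
/-- Quantum Rényi relative entropy `D_α(ρ‖σ) = (α - 1)⁻¹ log₂ Tr {ρ^α σ^(1-α)}` for
`0 ≤ α ≠ 1`, extended by the quantum relative entropy at `α = 1`. It is `+∞` if `α > 1` and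
`supp ρ ⊄ supp σ`, and, as `-log₂ 0 = +∞`, also if `α < 1` and the trace vanishes. -/
def renyiDiv {a : Type u} [Fintype a] [DecidableEq a] (α : ℝ) (ρ σ : Matrix a a ℂ) : EReal :=
  if α = 1 then relEntropy ρ σ
  else if (1 < α ∧ ¬ SuppLE ρ σ) ∨ (α < 1 ∧ renyiTrace α ρ σ = 0) then ⊤
  else ((1 / (α - 1) * Real.logb 2 (renyiTrace α ρ σ) : ℝ) : EReal)

/-- Rényi mutual information `I_α(R;B)_θ = D_α(θ_RB ‖ θ_R ⊗ θ_B)`. -/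
def renyiMI {r : Type u} {b : Type v} [Fintype r] [DecidableEq r] [Fintype b] [DecidableEq b]
    (α : ℝ) (θ : Matrix (r × b) (r × b) ℂ) : EReal :=
  renyiDiv α θ (traceRight θ ⊗ₖ traceLeft θ)

/-- `sup_θ I_α(R;B)_{N(θ)}` over all pure states `θ_RA = |ψ⟩⟨ψ|` of the channel input `A` and a
reference system `R` of arbitrary finite dimension. -/
def channelRenyiMI {a : Type u} {b : Type v} [Fintype a] [Fintype b] [DecidableEq b]
    (N : Matrix a a ℂ →ₗ[ℂ] Matrix b b ℂ) (α : ℝ) : EReal :=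
  ⨆ (k : ℕ) (ψ : Fin k × a → ℂ) (_ : ∑ i, ‖ψ i‖ ^ 2 = 1),
    renyiMI α (idTensor N (ketbra ψ))

/-! ### Entanglement-assisted codes and error exponents -/

/-- There is an `(M, ε)` entanglement-assisted classical code for the channel `N`: a shared state
`Ψ` of systems `R` (Bob) and `A` (Alice) of arbitrary finite dimensions, an encoding channel
`E m` from `A` to the input of `N` for each message `m`, and a decoding POVM `Λ` on `R` and the
output of `N`, with average error probability at most `ε`. -/
def HasCode {a : Type u} {b : Type v} [Fintype a] [Fintype b] [DecidableEq b]
    (N : Matrix a a ℂ →ₗ[ℂ] Matrix b b ℂ) (M : ℕ) (ε : ℝ) : Prop :=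
  ∃ (dR dA : ℕ) (Ψ : Matrix (Fin dR × Fin dA) (Fin dR × Fin dA) ℂ)
    (E : Fin M → (Matrix (Fin dA) (Fin dA) ℂ →ₗ[ℂ] Matrix a a ℂ))
    (Λ : Fin M → Matrix (Fin dR × b) (Fin dR × b) ℂ),
    IsDensity Ψ ∧ (∀ m, IsChannel (E m)) ∧ (∀ m, (Λ m).PosSemidef) ∧ ∑ m, Λ m = 1 ∧
    1 / (M : ℝ) * ∑ m, ((1 - Λ m) * idTensor N (idTensor (E m) Ψ)).trace.re ≤ ε

/-- `ε*(N, M)`: the infimum of the `ε ∈ [0,1]` for which an `(M, ε)` code exists. -/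
def optError {a : Type u} {b : Type v} [Fintype a] [Fintype b] [DecidableEq b]
    (N : Matrix a a ℂ →ₗ[ℂ] Matrix b b ℂ) (M : ℕ) : ℝ :=
  sInf {ε : ℝ | 0 ≤ ε ∧ ε ≤ 1 ∧ HasCode N M ε}

/-- `-log₂ x` for `x ≥ 0`, with `-log₂ 0 = +∞`. -/
def negLog2 (x : ℝ) : EReal :=
  if x = 0 then ⊤ else ((-Real.logb 2 x : ℝ) : EReal)

/-- The entanglement-assisted error exponent
`E_EA(N, R) = limsup_n [-(1/n) log₂ ε*(N^{⊗ n}, ⌈2^{nR}⌉)]`. -/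
def errorExponent {a : Type u} {b : Type v} [Fintype a] [DecidableEq a] [Fintype b]
    [DecidableEq b] (N : Matrix a a ℂ →ₗ[ℂ] Matrix b b ℂ) (R : ℝ) : EReal :=
  Filter.limsup
    (fun n : ℕ => ((1 / (n : ℝ) : ℝ) : EReal) *
      negLog2 (optError (tensorPow N n) ⌈(2 : ℝ) ^ ((n : ℝ) * R)⌉₊))
    Filter.atTop

end

end EACode

namespace EACode

/-! ### Powers on supports, Audenaert's inequality and the square-root measurement. -/

section MatrixAnalysis
open Matrix
open scoped MatrixOrder Matrix.Norms.L2Operator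

variable {ι κ : Type*} [Fintype ι] [DecidableEq ι] [Fintype κ] [DecidableEq κ]

/-! The codes are position-based. Bob and Alice share M copies of θ, and to send m Alice feeds her
half of the m-th copy into the channel. With ω = N(θ), Bob's position m and the channel output are
then in the state ω, while any other position and the output are in ω_R ⊗ ω_B. Decoding is thus
hypothesis testing between these two states: apply a test T at every position and combine the
results in a square-root measurement. `exists_povm` bounds the error by 2 Tr ω(1 - T) + 4(M - 1) Tr
(ω_R ⊗ ω_B)T (`hasCode_positionBased`).

For c ≥ M - 1, c > 0, Audenaert's inequality (`exists_test`) for ω against c · ω_R ⊗ ω_B supplies a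
T making this at most 4 c^(1-s) Tr ω^s (ω_R ⊗ ω_B)^(1-s). For the n-fold channel with input θ^{⊗n}
and c = 2^{nR}, the trace becomes an n-th power (`renyiTrace_zipPow`), so -1/n log₂ of the bound
tends to (1 - s)(I_s - R). -/

lemma continuousOn_spectrum (f : ℝ → ℝ) (A : Matrix ι ι ℂ) : ContinuousOn f (spectrum ℝ A) :=
  (Matrix.finite_real_spectrum (A := A)).continuousOn f

/-- The functional calculus of a matrix given in diagonalized form. -/
lemma cfc_conj_diagonal {U : Matrix ι κ ℂ} (h1 : Uᴴ * U = 1) (h2 : U * Uᴴ = 1) (d : κ → ℝ)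
    (f : ℝ → ℝ) :
    cfc f (U * diagonal (fun i => (d i : ℂ)) * Uᴴ) = U * diagonal (fun i => (f (d i) : ℂ)) * Uᴴ := by
  set A := U * diagonal (fun i => (d i : ℂ)) * Uᴴ with hAdef
  have hA : IsSelfAdjoint A := by
    have : IsHermitian A := by
      refine isHermitian_mul_mul_conjTranspose U ?_
      refine isHermitian_diagonal_of_self_adjoint _ ?_
      ext i; simp
    exact this
  -- On these nodes f is a polynomial. The left side needs the spectrum of `A`, the right side the
  -- entries `d i`; taking both avoids proving that they are the same set.
  let S : Finset ℝ := (Matrix.finite_real_spectrum (A := A)).toFinset ∪ Finset.univ.image d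
  let q : Polynomial ℝ := Lagrange.interpolate S id f
  have hq : ∀ x ∈ S, q.eval x = f x := fun x hx =>
    Lagrange.eval_interpolate_at_node (s := S) (v := id) f Function.injective_id.injOn hx
  have e1 : cfc f A = cfc q.eval A := by
    refine cfc_congr fun x hx => (hq x ?_).symm
    simp [S, hx]
  rw [e1, cfc_polynomial q A hA]
  have e2 : ∀ p : Polynomial ℝ, Polynomial.aeval A p =
      U * diagonal (fun i => ((p.eval (d i) : ℝ) : ℂ)) * Uᴴ := by
    intro p
    have hpow : ∀ n : ℕ, A ^ n = U * diagonal (fun i => ((d i ^ n : ℝ) : ℂ)) * Uᴴ := by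
      intro n
      induction n with
      | zero => simp [h2]
      | succ n ih =>
        rw [pow_succ, ih, hAdef]
        have : (diagonal (fun i => ((d i ^ (n + 1) : ℝ) : ℂ)) : Matrix κ κ ℂ)
            = diagonal (fun i => ((d i ^ n : ℝ) : ℂ)) * (Uᴴ * U) * diagonal (fun i => (d i : ℂ)) := by
          rw [h1, mul_one, diagonal_mul_diagonal]
          congr 1; ext i; push_cast; ring
        rw [this]; simp only [Matrix.mul_assoc]
    induction p using Polynomial.induction_on' with
    | add p q hp hq =>
      simp only [map_add, hp, hq, Polynomial.eval_add, Complex.ofReal_add]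
      rw [← diagonal_add, Matrix.mul_add, Matrix.add_mul]
    | monomial n c =>
      rw [Polynomial.aeval_monomial, hpow, ← Algebra.smul_def, ← Matrix.smul_mul, ← Matrix.mul_smul]
      congr 2
      ext i j
      by_cases hij : i = j <;> simp [diagonal, hij]
  rw [e2 q]
  congr 3
  ext i
  rw [hq _ (by simp [S])]

lemma exists_diagonalization {A : Matrix ι ι ℂ} (hA : A.IsHermitian) :
    ∃ (U : Matrix ι ι ℂ) (d : ι → ℝ), Uᴴ * U = 1 ∧ U * Uᴴ = 1 ∧
      A = U * diagonal (fun i => (d i : ℂ)) * Uᴴ := by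
  refine ⟨hA.eigenvectorUnitary, hA.eigenvalues, ?_, ?_, ?_⟩
  · exact Unitary.coe_star_mul_self hA.eigenvectorUnitary
  · exact Unitary.coe_mul_star_self hA.eigenvectorUnitary
  · conv_lhs => rw [hA.spectral_theorem]
    rfl

lemma trace_mul_nonneg {A B : Matrix ι ι ℂ} (hA : 0 ≤ A) (hB : 0 ≤ B) :
    0 ≤ (A * B).trace := by
  obtain ⟨C, rfl⟩ := CStarAlgebra.nonneg_iff_eq_star_mul_self.mp hA
  rw [star_eq_conjTranspose, Matrix.trace_mul_comm, ← Matrix.mul_assoc, Matrix.trace_mul_comm,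
    ← Matrix.mul_assoc]
  exact ((nonneg_iff_posSemidef.mp hB).mul_mul_conjTranspose_same C).trace_nonneg

lemma re_trace_mul_nonneg {A B : Matrix ι ι ℂ} (hA : 0 ≤ A) (hB : 0 ≤ B) :
    0 ≤ (A * B).trace.re :=
  (Complex.le_def.mp (trace_mul_nonneg hA hB)).1

lemma re_trace_mul_mono_right {A B C : Matrix ι ι ℂ} (hA : 0 ≤ A) (h : B ≤ C) :
    (A * B).trace.re ≤ (A * C).trace.re := by
  have := re_trace_mul_nonneg hA (sub_nonneg.mpr h)
  rw [Matrix.mul_sub, Matrix.trace_sub, Complex.sub_re] at this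
  linarith

lemma re_trace_mul_mono_left {A B C : Matrix ι ι ℂ} (hA : 0 ≤ A) (h : B ≤ C) :
    (B * A).trace.re ≤ (C * A).trace.re := by
  rw [Matrix.trace_mul_comm B, Matrix.trace_mul_comm C]
  exact re_trace_mul_mono_right hA h

lemma suppPow_nonneg {A : Matrix ι ι ℂ} (hA : 0 ≤ A) (p : ℝ) : 0 ≤ suppPow A p := by
  refine cfc_nonneg fun x hx => ?_
  have := spectrum_nonneg_of_nonneg hA hx
  split_ifs
  · exact le_rfl
  · positivity

/-- Exponents of any sign are allowed, even with p + q = 0, because every power vanishes on the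
kernel. This is what makes G^(-1/2) usable for singular G. -/
lemma suppPow_mul_suppPow {A : Matrix ι ι ℂ} (hA : 0 ≤ A) (p q : ℝ) :
    suppPow A p * suppPow A q = suppPow A (p + q) := by
  rw [suppPow, suppPow, ← cfc_mul _ _ A (continuousOn_spectrum _ A) (continuousOn_spectrum _ A)]
  refine cfc_congr fun x hx => ?_
  have := spectrum_nonneg_of_nonneg hA hx
  by_cases h : x = 0
  · simp [h]
  · simp only [h, if_false]
    rw [Real.rpow_add (lt_of_le_of_ne this (Ne.symm h))]

lemma suppPow_one {A : Matrix ι ι ℂ} (hA : 0 ≤ A) : suppPow A 1 = A := by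
  have : suppPow A 1 = cfc (id : ℝ → ℝ) A := by
    refine cfc_congr fun x hx => ?_
    by_cases h : x = 0 <;> simp [h]
  rw [this, cfc_id ℝ A (IsSelfAdjoint.of_nonneg hA)]

lemma suppPow_zero_le_one {A : Matrix ι ι ℂ} : suppPow A 0 ≤ 1 := by
  rw [suppPow]
  refine cfc_le_one _ _ fun x hx => ?_
  split_ifs <;> simp

lemma suppPow_eq_rpow {A : Matrix ι ι ℂ} (hA : 0 ≤ A) {p : ℝ} (hp : 0 < p) :
    suppPow A p = A ^ p := by
  rw [CFC.rpow_eq_cfc_real hA]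
  refine cfc_congr fun x hx => ?_
  by_cases h : x = 0
  · simp [h, Real.zero_rpow hp.ne']
  · simp [h]

/-- Löwner–Heinz. The exponent 0 is left out because there `suppPow` is the support projection while
the ordinary power is 1. -/
lemma suppPow_le_suppPow {A B : Matrix ι ι ℂ} (hA : 0 ≤ A) (h : A ≤ B) {p : ℝ} (hp : 0 < p)
    (hp1 : p ≤ 1) : suppPow A p ≤ suppPow B p := by
  rw [suppPow_eq_rpow hA hp, suppPow_eq_rpow (hA.trans h) hp]
  exact CFC.rpow_le_rpow ⟨hp.le, hp1⟩ h

lemma exists_nonneg_diagonalization {A : Matrix ι ι ℂ} (hA : 0 ≤ A) :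
    ∃ (U : Matrix ι ι ℂ) (d : ι → ℝ), Uᴴ * U = 1 ∧ U * Uᴴ = 1 ∧ (∀ i, 0 ≤ d i) ∧
      A = U * diagonal (fun i => (d i : ℂ)) * Uᴴ := by
  obtain ⟨U, d, h1, h2, hd⟩ := exists_diagonalization (nonneg_iff_posSemidef.mp hA).isHermitian
  refine ⟨U, d, h1, h2, ?_, hd⟩
  have := (nonneg_iff_posSemidef.mp hA).conjTranspose_mul_mul_same U
  have e3 : Uᴴ * A * U = diagonal (fun i => (d i : ℂ)) := by
    rw [hd]
    calc _ = (Uᴴ * U) * diagonal (fun i => (d i : ℂ)) * (Uᴴ * U) := by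
          simp only [Matrix.mul_assoc]
      _ = _ := by rw [h1]; simp
  rw [e3, posSemidef_diagonal_iff] at this
  exact fun i => by exact_mod_cast this i

lemma suppPow_smul {A : Matrix ι ι ℂ} (hA : 0 ≤ A) {c : ℝ} (hc : 0 < c) (p : ℝ) :
    suppPow ((c : ℂ) • A) p = ((c ^ p : ℝ) : ℂ) • suppPow A p := by
  obtain ⟨U, d, h1, h2, hd0, hd⟩ := exists_nonneg_diagonalization hA
  have e : (c : ℂ) • A = U * diagonal (fun i => ((c * d i : ℝ) : ℂ)) * Uᴴ := by
    rw [hd, ← Matrix.smul_mul, ← Matrix.mul_smul, ← diagonal_smul]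
    congr 3; ext i; simp
  have e2 : suppPow A p = U * diagonal (fun i => ((if d i = 0 then 0 else d i ^ p : ℝ) : ℂ)) * Uᴴ := by
    rw [suppPow, hd, cfc_conj_diagonal h1 h2]
  rw [e, e2, suppPow, cfc_conj_diagonal h1 h2, ← Matrix.smul_mul, ← Matrix.mul_smul, ← diagonal_smul]
  congr 3; ext i
  by_cases h : d i = 0
  · simp [h]
  · simp [h, hc.ne', Real.mul_rpow hc.le (hd0 i)]

lemma suppPow_submatrix {A : Matrix ι ι ℂ} (hA : 0 ≤ A) (e : κ ≃ ι) (p : ℝ) :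
    suppPow (A.submatrix e e) p = (suppPow A p).submatrix e e := by
  obtain ⟨U, d, h1, h2, hd0, hd⟩ := exists_nonneg_diagonalization hA
  have h1' : (U.submatrix e id)ᴴ * U.submatrix e id = 1 := by
    rw [conjTranspose_submatrix, submatrix_mul_equiv, h1, submatrix_id_id]
  have h2' : U.submatrix e id * (U.submatrix e id)ᴴ = 1 := by
    rw [conjTranspose_submatrix, ← submatrix_mul _ _ _ _ _ Function.bijective_id, h2,
      submatrix_one_equiv]
  have k : ∀ D : Matrix ι ι ℂ, (U * D * Uᴴ).submatrix e e =
      U.submatrix e id * D * (U.submatrix e id)ᴴ := by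
    intro D
    rw [submatrix_mul _ _ _ id _ Function.bijective_id,
      submatrix_mul _ _ _ id _ Function.bijective_id, submatrix_id_id, conjTranspose_submatrix]
  rw [suppPow, suppPow, hd, k, cfc_conj_diagonal h1' h2', cfc_conj_diagonal h1 h2, k]

lemma renyiTrace_nonneg {A B : Matrix ι ι ℂ} (hA : 0 ≤ A) (hB : 0 ≤ B) (s : ℝ) :
    0 ≤ renyiTrace s A B :=
  re_trace_mul_nonneg (suppPow_nonneg hA _) (suppPow_nonneg hB _)

/-- Audenaert's inequality, in the form of the existence of a good binary test. -/
lemma exists_test {A B : Matrix ι ι ℂ} (hA : 0 ≤ A) (hB : 0 ≤ B) {s : ℝ} (hs : 0 ≤ s)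
    (hs1 : s < 1) :
    ∃ T : Matrix ι ι ℂ, 0 ≤ T ∧ T ≤ 1 ∧
      (A * (1 - T)).trace.re + (B * T).trace.re ≤ renyiTrace s A B := by
  rcases hs.eq_or_lt with rfl | hs
  · refine ⟨suppPow A 0, suppPow_nonneg hA 0, suppPow_zero_le_one, ?_⟩
    have h1 : A * suppPow A 0 = A := by
      conv_lhs => enter [1]; rw [← suppPow_one hA]
      rw [suppPow_mul_suppPow hA, add_zero, suppPow_one hA]
    rw [Matrix.mul_sub, h1, renyiTrace, sub_zero, suppPow_one hB, Matrix.trace_mul_comm B]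
    simp
  have hAB : IsSelfAdjoint (A - B) :=
    (IsSelfAdjoint.of_nonneg hA).sub (IsSelfAdjoint.of_nonneg hB)
  set T : Matrix ι ι ℂ := cfc (fun x : ℝ => if 0 < x then 1 else 0) (A - B) with hT
  set D := (A - B) * T with hD
  have hD' : D = cfc (fun x : ℝ => max x 0) (A - B) := by
    have h0 : A - B = cfc (fun x : ℝ => x) (A - B) := (cfc_id' ℝ (A - B)).symm
    rw [hD, hT]
    conv_lhs => enter [1]; rw [h0]
    rw [← cfc_mul _ _ _ (continuousOn_spectrum _ _) (continuousOn_spectrum _ _)]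
    refine cfc_congr fun x _ => ?_
    by_cases h : 0 < x
    · simp [h, h.le]
    · simp [h, not_lt.mp h]
  have hD0 : 0 ≤ D := by
    rw [hD']; exact cfc_nonneg fun x _ => le_max_right _ _
  have hDle : A - B ≤ D := by
    rw [hD']
    conv_lhs => rw [← cfc_id' ℝ (A - B)]
    exact cfc_mono (fun x _ => le_max_left _ _) (continuousOn_spectrum _ _)
      (continuousOn_spectrum _ _)
  refine ⟨T, cfc_nonneg fun x _ => by split_ifs <;> simp,
    cfc_le_one _ _ fun x _ => by split_ifs <;> simp, ?_⟩
  have hAX : A ≤ B + D := by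
    have := add_le_add_right hDle B
    simpa using this
  have hBX : B ≤ B + D := le_add_of_nonneg_right hD0
  have hX : 0 ≤ B + D := hB.trans hBX
  have k1 : (suppPow A s * suppPow A (1 - s)).trace.re = A.trace.re := by
    rw [suppPow_mul_suppPow hA, add_sub_cancel, suppPow_one hA]
  have k2 : (suppPow B s * suppPow B (1 - s)).trace.re = B.trace.re := by
    rw [suppPow_mul_suppPow hB, add_sub_cancel, suppPow_one hB]
  have k3 : (suppPow (B + D) s * suppPow (B + D) (1 - s)).trace.re = (B + D).trace.re := by
    rw [suppPow_mul_suppPow hX, add_sub_cancel, suppPow_one hX]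
  -- With X = B + (A - B)₊, which dominates both `A` and `B`: Tr A - Tr A^s B^(1-s) ≤ Tr A^s
  -- (X^(1-s) - B^(1-s)) ≤ Tr X^s (X^(1-s) - B^(1-s)) ≤ Tr X - Tr B = Tr (A - B)₊. The three
  -- inequalities are `q1`, `q2`, `q3`.
  have p1 := suppPow_le_suppPow hB hBX (p := 1 - s) (by linarith) (by linarith)
  have p2 := suppPow_le_suppPow hA hAX hs hs1.le
  have p3 := suppPow_le_suppPow hB hBX hs hs1.le
  have p4 := suppPow_le_suppPow hA hAX (p := 1 - s) (by linarith) (by linarith)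
  have q1 := re_trace_mul_mono_right (suppPow_nonneg hA s) p4
  have q2 := re_trace_mul_nonneg (sub_nonneg.mpr p2) (sub_nonneg.mpr p1)
  have q3 := re_trace_mul_mono_left (suppPow_nonneg hB (1 - s)) p3
  have e1 : (A * (1 - T)).trace.re + (B * T).trace.re = A.trace.re - D.trace.re := by
    rw [hD, Matrix.mul_sub, Matrix.sub_mul, Matrix.trace_sub, Matrix.trace_sub, Matrix.mul_one,
      Complex.sub_re, Complex.sub_re]
    ring
  rw [Matrix.sub_mul, Matrix.mul_sub, Matrix.mul_sub] at q2
  simp only [Matrix.trace_sub, Complex.sub_re] at q2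
  rw [Matrix.trace_add, Complex.add_re] at k3
  rw [e1, renyiTrace]
  linarith

/-- The Hayashi–Nagaoka operator inequality, applied to the square-root measurement of a family of
effects; the defect of the measurement is added to one of the outcomes. -/
lemma exists_povm {μ : Type*} [Fintype μ] [DecidableEq μ] [Nonempty μ] (T : μ → Matrix ι ι ℂ)
    (h0 : ∀ m, 0 ≤ T m) (h1 : ∀ m, T m ≤ 1) :
    ∃ Λ : μ → Matrix ι ι ℂ, (∀ m, 0 ≤ Λ m) ∧ ∑ m, Λ m = 1 ∧
      ∀ m, 1 - Λ m ≤ (2 : ℝ) • (1 - T m) + (4 : ℝ) • (∑ j, T j - T m) := by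
  classical
  set G := ∑ j, T j with hG
  have hG0 : 0 ≤ G := Finset.sum_nonneg fun j _ => h0 j
  set W := suppPow G (-1 / 2) with hW
  set Q := suppPow G (1 / 2) with hQ
  set P := suppPow G 0 with hP
  have hW0 : 0 ≤ W := suppPow_nonneg hG0 _
  have hWs : Wᴴ = W := (nonneg_iff_posSemidef.mp hW0).isHermitian
  have hWG : W * G = Q := by
    conv_lhs => enter [2]; rw [← suppPow_one hG0]
    rw [hW, suppPow_mul_suppPow hG0, hQ]; norm_num
  have hGW : G * W = Q := by
    conv_lhs => enter [1]; rw [← suppPow_one hG0]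
    rw [hW, suppPow_mul_suppPow hG0, hQ]; norm_num
  have hQW : Q * W = P := by
    rw [hW, hQ, suppPow_mul_suppPow hG0, hP]; norm_num
  have hP1 : 0 ≤ 1 - P := sub_nonneg.mpr suppPow_zero_le_one
  have hconj : ∀ {X Y : Matrix ι ι ℂ}, 0 ≤ X → Yᴴ = Y → 0 ≤ Y * X * Y := by
    intro X Y hX hY
    have := (nonneg_iff_posSemidef.mp hX).mul_mul_conjTranspose_same Y
    rw [hY] at this
    exact nonneg_iff_posSemidef.mpr this
  have key : ∀ m, 1 - W * T m * W ≤ (2 : ℝ) • (1 - T m) + (4 : ℝ) • (G - T m) := by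
    intro m
    have hTG : T m ≤ G := Finset.single_le_sum (fun j _ => h0 j) (Finset.mem_univ m)
    -- T ≤ T^(1/2) since 0 ≤ T ≤ 1, and T^(1/2) ≤ G^(1/2) by monotonicity of the square root.
    have hTQ : T m ≤ Q := by
      refine le_trans ?_ (suppPow_le_suppPow (h0 m) hTG (by norm_num) (by norm_num))
      conv_lhs => rw [← suppPow_one (h0 m)]
      refine cfc_mono (fun x hx => ?_) (continuousOn_spectrum _ _) (continuousOn_spectrum _ _)
      have hx0 := spectrum_nonneg_of_nonneg (h0 m) hx
      have hx1 : x ≤ 1 := (CFC.le_one_iff (R := ℝ) _ (IsSelfAdjoint.of_nonneg (h0 m))).mp (h1 m) x hx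
      by_cases h : x = 0
      · simp [h]
      · simp only [h, if_false]
        exact Real.rpow_le_rpow_of_exponent_ge (lt_of_le_of_ne hx0 (Ne.symm h)) hx1 (by norm_num)
    -- The right side minus the left side is exactly (W - 2)(G - T)(W - 2) + (1 - P) + 4(Q - T) +
    -- 2(W - 1)T(W - 1), a sum of positive terms.
    have a1 := hconj (sub_nonneg.mpr hTG) (Y := W - (2 : ℝ) • 1) (by simp [hWs])
    have a2 := smul_nonneg (show (0 : ℝ) ≤ 4 by norm_num) (sub_nonneg.mpr hTQ)
    have a3 := smul_nonneg (show (0 : ℝ) ≤ 2 by norm_num)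
      (hconj (h0 m) (Y := W - 1) (by simp [hWs]))
    have := add_nonneg (add_nonneg (add_nonneg a1 hP1) a2) a3
    rw [← sub_nonneg]
    convert this using 1
    have e1 : (W - (2 : ℝ) • 1) * (G - T m) * (W - (2 : ℝ) • 1)
        = P - W * T m * W - (4 : ℝ) • Q + (2 : ℝ) • (W * T m) + (2 : ℝ) • (T m * W)
          + (4 : ℝ) • (G - T m) := by
      simp only [Matrix.sub_mul, Matrix.mul_sub, hWG, hQW, hGW, Matrix.smul_mul, Matrix.mul_smul,
        Matrix.one_mul, Matrix.mul_one, smul_sub, smul_smul]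
      module
    have e2 : (W - 1) * T m * (W - 1) = W * T m * W - W * T m - T m * W + T m := by
      noncomm_ring
    rw [e1, e2]
    module
  obtain ⟨m₀⟩ := ‹Nonempty μ›
  refine ⟨fun m => W * T m * W + if m = m₀ then 1 - P else 0, fun m => ?_, ?_, fun m => ?_⟩
  · refine add_nonneg (hconj (h0 m) hWs) ?_
    split_ifs
    · exact hP1
    · exact le_rfl
  · rw [Finset.sum_add_distrib, ← Finset.sum_mul, ← Finset.mul_sum, ← hG, hWG, hQW]
    simp
  · refine le_trans ?_ (key m)
    refine sub_le_sub_left (le_add_of_nonneg_right ?_) _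
    split_ifs
    · exact hP1
    · exact le_rfl

end MatrixAnalysis
-- Multiplicativity under tensor powers.
section TensorPowers
set_option linter.unusedSectionVars false
open Matrix
open scoped MatrixOrder Matrix.Norms.L2Operator

variable {ι κ τ μ : Type*} [Fintype ι] [DecidableEq ι] [Fintype κ] [DecidableEq κ] [Fintype τ]
  [Fintype μ] [DecidableEq μ]

/-- The tensor product of the matrices `A m`. -/
def piKron {ι κ μ : Type*} [Fintype μ] (A : μ → Matrix ι κ ℂ) : Matrix (μ → ι) (μ → κ) ℂ :=
  Matrix.of fun x y => ∏ m, A m (x m) (y m)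

lemma piKron_mul (A : μ → Matrix ι κ ℂ) (B : μ → Matrix κ τ ℂ) :
    piKron A * piKron B = piKron fun m => A m * B m := by
  ext x y
  simp only [piKron, mul_apply, of_apply, ← Finset.prod_mul_distrib]
  exact (Fintype.prod_sum fun m k => A m (x m) k * B m k (y m)).symm

lemma piKron_conjTranspose (A : μ → Matrix ι κ ℂ) :
    (piKron A)ᴴ = piKron fun m => (A m)ᴴ := by
  ext x y
  simp [piKron, conjTranspose_apply]

lemma piKron_diagonal (d : μ → ι → ℂ) :
    piKron (fun m => diagonal (d m)) = diagonal fun x => ∏ m, d m (x m) := by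
  ext x y
  by_cases h : x = y
  · subst h; simp [piKron]
  · obtain ⟨m, hm⟩ := Function.ne_iff.mp h
    rw [diagonal_apply_ne _ h, piKron, of_apply]
    exact Finset.prod_eq_zero (Finset.mem_univ m) (diagonal_apply_ne _ hm)

lemma piKron_one : piKron (fun _ : μ => (1 : Matrix ι ι ℂ)) = 1 := by
  have := piKron_diagonal (fun (_ : μ) (_ : ι) => (1 : ℂ))
  simpa using this

lemma trace_piKron (A : μ → Matrix ι ι ℂ) : (piKron A).trace = ∏ m, (A m).trace := by
  simp only [trace, diag_apply, piKron, of_apply]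
  exact (Fintype.prod_sum fun m k => A m k k).symm

lemma piKron_nonneg {A : μ → Matrix ι ι ℂ} (hA : ∀ m, 0 ≤ A m) : 0 ≤ piKron A := by
  choose C hC using fun m => CStarAlgebra.nonneg_iff_eq_star_mul_self.mp (hA m)
  have : piKron A = (piKron C)ᴴ * piKron C := by
    rw [piKron_conjTranspose, piKron_mul]
    congr 1
    funext m
    exact hC m
  rw [this]
  exact nonneg_iff_posSemidef.mpr (posSemidef_conjTranspose_mul_self _)

lemma suppPow_piKron {A : Matrix ι ι ℂ} (hA : 0 ≤ A) (p : ℝ) :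
    suppPow (piKron fun _ : μ => A) p = piKron fun _ : μ => suppPow A p := by
  obtain ⟨U, d, h1, h2, hd0, hd⟩ := exists_nonneg_diagonalization hA
  have h1' : (piKron fun _ : μ => U)ᴴ * (piKron fun _ : μ => U) = 1 := by
    rw [piKron_conjTranspose, piKron_mul, h1, piKron_one]
  have h2' : (piKron fun _ : μ => U) * (piKron fun _ : μ => U)ᴴ = 1 := by
    rw [piKron_conjTranspose, piKron_mul, h2, piKron_one]
  have k : ∀ g : ι → ℝ, (piKron fun _ : μ => U * diagonal (fun i => (g i : ℂ)) * Uᴴ) =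
      (piKron fun _ : μ => U) * diagonal (fun x : μ → ι => ((∏ m, g (x m) : ℝ) : ℂ)) *
        (piKron fun _ : μ => U)ᴴ := by
    intro g
    rw [← piKron_mul, ← piKron_mul, piKron_diagonal, piKron_conjTranspose]
    simp only [Complex.ofReal_prod]
  rw [suppPow, suppPow, hd, k, cfc_conj_diagonal h1' h2', cfc_conj_diagonal h1 h2, k]
  congr 3
  ext x
  congr 1
  -- The scalar power with value 0 at 0 is multiplicative on nonnegative reals, since a product
  -- vanishes exactly when some factor does.
  by_cases h : ∏ m, d (x m) = 0
  · obtain ⟨m, -, hm⟩ := Finset.prod_eq_zero_iff.mp h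
    rw [if_pos h, Finset.prod_eq_zero (Finset.mem_univ m)]
    rw [if_pos hm]
  · rw [if_neg h, ← Real.finsetProd_rpow _ _ fun m _ => hd0 _]
    refine Finset.prod_congr rfl fun m _ => ?_
    rw [if_neg]
    exact Finset.prod_ne_zero_iff.mp h m (Finset.mem_univ m)

variable {r a b : Type*} [Fintype r] [DecidableEq r] [Fintype a] [DecidableEq a] [Fintype b]
  [DecidableEq b]

/-- Pairs of strings as strings of pairs. -/
abbrev zipEquiv (μ r b : Type*) : (μ → r) × (μ → b) ≃ (μ → r × b) :=
  (Equiv.arrowProdEquivProdArrow μ (fun _ => r) (fun _ => b)).symm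

/-- The product state on `R^μ ⊗ B^μ`. -/
def zipPow (μ : Type*) [Fintype μ] {r b : Type*} (X : Matrix (r × b) (r × b) ℂ) :
    Matrix ((μ → r) × (μ → b)) ((μ → r) × (μ → b)) ℂ :=
  (piKron fun _ : μ => X).submatrix (zipEquiv μ r b) (zipEquiv μ r b)

lemma zipPow_apply (X : Matrix (r × b) (r × b) ℂ) (p q : (μ → r) × (μ → b)) :
    zipPow μ X p q = ∏ m, X (p.1 m, p.2 m) (q.1 m, q.2 m) := rfl

lemma traceRight_zipPow (X : Matrix (r × b) (r × b) ℂ) :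
    traceRight (zipPow μ X) = piKron fun _ : μ => traceRight X := by
  ext x y
  simp only [traceRight, of_apply, zipPow_apply, piKron]
  exact (Fintype.prod_sum fun m k => X (x m, k) (y m, k)).symm

lemma traceLeft_zipPow (X : Matrix (r × b) (r × b) ℂ) :
    traceLeft (zipPow μ X) = piKron fun _ : μ => traceLeft X := by
  ext x y
  simp only [traceLeft, of_apply, zipPow_apply, piKron]
  exact (Fintype.prod_sum fun m k => X (k, x m) (k, y m)).symm

lemma zipPow_kronecker (X : Matrix r r ℂ) (Y : Matrix b b ℂ) :
    zipPow μ (X ⊗ₖ Y) = (piKron fun _ : μ => X) ⊗ₖ (piKron fun _ : μ => Y) := by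
  ext x y
  simp [zipPow_apply, piKron, kroneckerMap_apply, Finset.prod_mul_distrib]

lemma submatrix_nonneg {A : Matrix ι ι ℂ} (hA : 0 ≤ A) (f : κ → ι) : 0 ≤ A.submatrix f f :=
  nonneg_iff_posSemidef.mpr ((nonneg_iff_posSemidef.mp hA).submatrix f)

lemma trace_submatrix_equiv (A : Matrix ι ι ℂ) (e : κ ≃ ι) : (A.submatrix e e).trace = A.trace := by
  simp only [trace, diag_apply, submatrix_apply]
  exact e.sum_comp fun i => A i i

lemma zipPow_nonneg {X : Matrix (r × b) (r × b) ℂ} (hX : 0 ≤ X) : 0 ≤ zipPow μ X :=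
  submatrix_nonneg (piKron_nonneg fun _ => hX) _

lemma trace_zipPow (X : Matrix (r × b) (r × b) ℂ) :
    (zipPow μ X).trace = X.trace ^ Fintype.card μ := by
  rw [zipPow, trace_submatrix_equiv, trace_piKron, Finset.prod_const, Finset.card_univ]

/-- Expanding `N` in matrix units turns the product over positions of sums over pairs into the sum
over pairs of strings that defines `tensorPow`. -/
lemma idTensor_tensorPow (N : Matrix a a ℂ →ₗ[ℂ] Matrix b b ℂ) (n : ℕ)
    (X : Matrix (r × a) (r × a) ℂ) :
    idTensor (tensorPow N n) (zipPow (Fin n) X) = zipPow (Fin n) (idTensor N X) := by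
  have hN : ∀ (Y : Matrix a a ℂ) (u v : b),
      N Y u v = ∑ p : a × a, Y p.1 p.2 * N (single p.1 p.2 1) u v := by
    intro Y u v
    conv_lhs => rw [matrix_eq_sum_single Y]
    rw [Fintype.sum_prod_type]
    simp only [map_sum, Matrix.sum_apply]
    refine Finset.sum_congr rfl fun i _ => Finset.sum_congr rfl fun j _ => ?_
    have : single i j (Y i j) = Y i j • single i j (1 : ℂ) := by simp
    rw [this, map_smul, Matrix.smul_apply, smul_eq_mul]
  ext p q
  rw [zipPow_apply]
  simp only [idTensor, of_apply, tensorPow, LinearMap.coe_mk, AddHom.coe_mk, zipPow_apply]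
  simp_rw [hN (Matrix.of _)]
  rw [Fintype.prod_sum, ← (zipEquiv (Fin n) a a).sum_comp, Fintype.sum_prod_type]
  simp [Finset.prod_mul_distrib]

lemma renyiTrace_zipPow {X Y : Matrix (r × b) (r × b) ℂ} (hX : 0 ≤ X) (hY : 0 ≤ Y) (s : ℝ) :
    renyiTrace s (zipPow μ X) (zipPow μ Y) = renyiTrace s X Y ^ Fintype.card μ := by
  have h := trace_mul_nonneg (suppPow_nonneg hX s) (suppPow_nonneg hY (1 - s))
  -- The trace is real, so taking real parts commutes with the power.
  have hre : (suppPow X s * suppPow Y (1 - s)).trace = (renyiTrace s X Y : ℂ) :=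
    Complex.ext rfl (by simpa using (Complex.le_def.mp h).2.symm)
  rw [renyiTrace, zipPow, zipPow, suppPow_submatrix (piKron_nonneg fun _ => hX),
    suppPow_submatrix (piKron_nonneg fun _ => hY), suppPow_piKron hX, suppPow_piKron hY,
    submatrix_mul_equiv, piKron_mul, trace_submatrix_equiv, trace_piKron, Finset.prod_const, hre,
    ← Complex.ofReal_pow, Complex.ofReal_re, Finset.card_univ]

lemma traceRight_nonneg {X : Matrix (r × b) (r × b) ℂ} (hX : 0 ≤ X) : 0 ≤ traceRight X := by
  have : traceRight X = ∑ k, X.submatrix (fun i => (i, k)) (fun i => (i, k)) := by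
    ext i j; simp [traceRight, Matrix.sum_apply]
  rw [this]
  exact Finset.sum_nonneg fun k _ => submatrix_nonneg hX _

lemma traceLeft_nonneg {X : Matrix (r × b) (r × b) ℂ} (hX : 0 ≤ X) : 0 ≤ traceLeft X := by
  have : traceLeft X = ∑ k, X.submatrix (fun i => (k, i)) (fun i => (k, i)) := by
    ext i j; simp [traceLeft, Matrix.sum_apply]
  rw [this]
  exact Finset.sum_nonneg fun k _ => submatrix_nonneg hX _

lemma kronecker_nonneg {X : Matrix r r ℂ} {Y : Matrix b b ℂ} (hX : 0 ≤ X) (hY : 0 ≤ Y) :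
    0 ≤ X ⊗ₖ Y :=
  nonneg_iff_posSemidef.mpr
    ((nonneg_iff_posSemidef.mp hX).kronecker (nonneg_iff_posSemidef.mp hY))

end TensorPowers
-- Position-based coding and the one-shot error bound.
section PositionBasedCoding
set_option linter.unusedSectionVars false
open Matrix
open scoped MatrixOrder Matrix.Norms.L2Operator

variable {μ r a b : Type*} [Fintype μ] [DecidableEq μ] [Fintype r] [DecidableEq r] [Fintype a]
  [DecidableEq a] [Fintype b] [DecidableEq b]

/-- A code with systems indexed by arbitrary finite types is a code. -/
lemma HasCode.of_fintype {N : Matrix a a ℂ →ₗ[ℂ] Matrix b b ℂ} {M : ℕ} {ε : ℝ}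
    {r' a' : Type*} [Fintype r'] [DecidableEq r'] [Fintype a'] [DecidableEq a']
    {Ψ : Matrix (r' × a') (r' × a') ℂ} {E : Fin M → (Matrix a' a' ℂ →ₗ[ℂ] Matrix a a ℂ)}
    {Λ : Fin M → Matrix (r' × b) (r' × b) ℂ} (hΨ : IsDensity Ψ) (hE : ∀ m, IsChannel (E m))
    (hΛ : ∀ m, 0 ≤ Λ m) (hsum : ∑ m, Λ m = 1)
    (hε : 1 / (M : ℝ) * ∑ m, ((1 - Λ m) * idTensor N (idTensor (E m) Ψ)).trace.re ≤ ε) :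
    HasCode N M ε := by
  let e := (Fintype.equivFin r').symm
  let f := (Fintype.equivFin a').symm
  let F : Matrix (Fin (Fintype.card a')) (Fin (Fintype.card a')) ℂ →ₗ[ℂ] Matrix a' a' ℂ :=
    (reindexLinearEquiv ℂ ℂ f f).toLinearMap
  refine ⟨Fintype.card r', Fintype.card a',
    Ψ.submatrix (Prod.map e f) (Prod.map e f), fun m => E m ∘ₗ F,
    fun m => (Λ m).submatrix (Prod.map e id) (Prod.map e id), ⟨hΨ.1.submatrix _, ?_⟩, fun m => ⟨?_, ?_⟩,
    fun m => nonneg_iff_posSemidef.mp (submatrix_nonneg (hΛ m) _), ?_, ?_⟩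
  · rw [← hΨ.2]
    exact trace_submatrix_equiv Ψ (Equiv.prodCongr e f)
  · intro X
    rw [LinearMap.comp_apply, (hE m).trace_preserving]
    exact trace_submatrix_equiv X f.symm
  · intro k X hX
    exact (hE m).completely_positive k _ (hX.submatrix (Prod.map id f.symm))
  · have : ∑ m, (Λ m).submatrix (Prod.map e id) (Prod.map e id)
        = (∑ m, Λ m).submatrix (Prod.map e id) (Prod.map e id) := by
      ext i j; simp [Matrix.sum_apply]
    rw [this, hsum]
    exact submatrix_one_equiv (Equiv.prodCongr e (Equiv.refl b))
  · refine le_trans (le_of_eq ?_) hε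
    congr 1
    refine Finset.sum_congr rfl fun m _ => ?_
    let g := Equiv.prodCongr e (Equiv.refl b)
    have h1 : (1 : Matrix (Fin (Fintype.card r') × b) (Fin (Fintype.card r') × b) ℂ)
        - (Λ m).submatrix (Prod.map e id) (Prod.map e id) = (1 - Λ m).submatrix g g := by
      rw [submatrix_sub, Pi.sub_apply, Pi.sub_apply, submatrix_one_equiv]
      rfl
    have h2 : idTensor N (idTensor (E m ∘ₗ F) (Ψ.submatrix (Prod.map e f) (Prod.map e f))) =
        (idTensor N (idTensor (E m) Ψ)).submatrix g g := by
      ext p q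
      have : ∀ x x' : r', F (Matrix.of fun i j => Ψ (x, f i) (x', f j)) =
          Matrix.of fun i j => Ψ (x, i) (x', j) := by
        intro x x'; ext i j; simp [F]
      simp only [idTensor, of_apply, submatrix_apply, LinearMap.comp_apply, Prod.map_apply, this]
      rfl
    rw [h1, h2, submatrix_mul_equiv, trace_submatrix_equiv]

/-- Splitting the position `m` off a string. -/
def splitEquiv {μ : Type*} [DecidableEq μ] (m : μ) (r b : Type*) :
    (μ → r) × b ≃ (r × b) × ({i // i ≠ m} → r) where
  toFun p := ((p.1 m, p.2), fun i => p.1 i)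
  invFun q := ((Equiv.piSplitAt m fun _ => r).symm (q.1.1, q.2), q.1.2)
  left_inv p := Prod.ext ((Equiv.piSplitAt m fun _ => r).symm_apply_apply p.1) rfl
  right_inv q := by
    have h := (Equiv.piSplitAt m fun _ => r).apply_symm_apply (q.1.1, q.2)
    have h1 := congrArg Prod.fst h
    have h2 := congrArg Prod.snd h
    exact Prod.ext (Prod.ext h1 rfl) h2

/-- Tracing out all positions but `m`. -/
def marginal {μ : Type*} [Fintype μ] [DecidableEq μ] (a : Type*) [Fintype a] (m : μ) :
    Matrix (μ → a) (μ → a) ℂ →ₗ[ℂ] Matrix a a ℂ where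
  toFun X := Matrix.of fun z z' => ∑ w, X ((Equiv.piSplitAt m fun _ => a).symm (z, w))
    ((Equiv.piSplitAt m fun _ => a).symm (z', w))
  map_add' X Y := by ext z z'; simp [Finset.sum_add_distrib]
  map_smul' c X := by ext z z'; simp [Finset.mul_sum]

lemma isChannel_marginal (m : μ) : IsChannel (marginal a m) where
  trace_preserving X := by
    simp only [trace, diag_apply, marginal, LinearMap.coe_mk, AddHom.coe_mk, of_apply]
    rw [← (Equiv.piSplitAt m fun _ => a).symm.sum_comp, Fintype.sum_prod_type]
  completely_positive k X hX := by
    have : idTensor (marginal a m) X = ∑ w,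
        X.submatrix (fun p => (p.1, (Equiv.piSplitAt m fun _ => a).symm (p.2, w)))
          (fun p => (p.1, (Equiv.piSplitAt m fun _ => a).symm (p.2, w))) := by
      ext p q
      simp [idTensor, marginal, Matrix.sum_apply]
    rw [this]
    exact posSemidef_sum _ fun w _ => hX.submatrix _

lemma prod_eq_mul_prod_ne (m : μ) (f : μ → ℂ) : ∏ i, f i = f m * ∏ i : {i // i ≠ m}, f i := by
  rw [← Finset.mul_prod_erase _ _ (Finset.mem_univ m)]
  congr 1
  exact Finset.prod_subtype _ (by simp) f

/-- The partial trace of a product over all positions but one. The factors may vary with the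
position, so this serves both the encoder and the marginals of `outState`. -/
lemma sum_prod_piSplitAt (m : μ) (g : μ → Matrix a a ℂ) (z z' : a) :
    ∑ w, ∏ i, g i ((Equiv.piSplitAt m fun _ => a).symm (z, w) i)
      ((Equiv.piSplitAt m fun _ => a).symm (z', w) i) =
    g m z z' * ∏ i : {i // i ≠ m}, (g i).trace := by
  have h : ∀ w, ∏ i, g i ((Equiv.piSplitAt m fun _ => a).symm (z, w) i)
      ((Equiv.piSplitAt m fun _ => a).symm (z', w) i) =
      g m z z' * ∏ i : {i // i ≠ m}, g i (w i) (w i) := by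
    intro w
    rw [prod_eq_mul_prod_ne m]
    congr 1
    · simp
    · refine Finset.prod_congr rfl fun i _ => ?_
      simp [i.2]
  simp_rw [h]
  rw [← Finset.mul_sum]
  congr 1
  simp only [trace, diag_apply]
  exact (Fintype.prod_sum fun (i : {i // i ≠ m}) k => g i k k).symm

/-- The channel output when the position `m` of the shared product state is sent. -/
def outState (ω : Matrix (r × b) (r × b) ℂ) (m : μ) : Matrix ((μ → r) × b) ((μ → r) × b) ℂ :=
  (ω ⊗ₖ piKron fun _ : {i // i ≠ m} => traceRight ω).submatrix (splitEquiv m r b) (splitEquiv m r b)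

lemma outState_nonneg {ω : Matrix (r × b) (r × b) ℂ} (hω : 0 ≤ ω) (m : μ) : 0 ≤ outState ω m :=
  submatrix_nonneg (kronecker_nonneg hω (piKron_nonneg fun _ => traceRight_nonneg hω)) _

/-- Discarding Alice's other halves leaves θ_R at the other positions, a scalar in each block that
`N` passes through. The hypothesis rewrites θ_R as a marginal of the output. -/
lemma idTensor_marginal (N : Matrix a a ℂ →ₗ[ℂ] Matrix b b ℂ) {θ : Matrix (r × a) (r × a) ℂ}
    (h : traceRight (idTensor N θ) = traceRight θ) (m : μ) :
    idTensor N (idTensor (marginal a m) (zipPow μ θ)) = outState (idTensor N θ) m := by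
  have key : ∀ x x' : μ → r, (Matrix.of fun z z' => idTensor (marginal a m) (zipPow μ θ) (x, z) (x', z'))
      = (∏ i : {i // i ≠ m}, traceRight θ (x i) (x' i)) •
        Matrix.of fun z z' => θ (x m, z) (x' m, z') := by
    intro x x'
    ext z z'
    simp only [idTensor, marginal, LinearMap.coe_mk, AddHom.coe_mk, of_apply, zipPow_apply,
      Matrix.smul_apply, smul_eq_mul]
    rw [mul_comm]
    exact sum_prod_piSplitAt m (fun i => Matrix.of fun k k' => θ (x i, k) (x' i, k')) z z'
  ext p q
  rw [outState, h, idTensor]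
  simp only [of_apply]
  rw [key, map_smul, Matrix.smul_apply, smul_eq_mul, mul_comm]
  rfl

/-- The effect `T` on position `j` and the channel output. -/
def localTest (T : Matrix (r × b) (r × b) ℂ) (j : μ) : Matrix ((μ → r) × b) ((μ → r) × b) ℂ :=
  (T ⊗ₖ (1 : Matrix ({i // i ≠ j} → r) ({i // i ≠ j} → r) ℂ)).submatrix
    (splitEquiv j r b) (splitEquiv j r b)

lemma localTest_nonneg {T : Matrix (r × b) (r × b) ℂ} (hT : 0 ≤ T) (j : μ) : 0 ≤ localTest T j :=
  submatrix_nonneg (kronecker_nonneg hT (nonneg_iff_posSemidef.mpr PosSemidef.one)) _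

lemma one_sub_localTest (T : Matrix (r × b) (r × b) ℂ) (j : μ) :
    1 - localTest T j = localTest (1 - T) j := by
  have : (1 : Matrix ((μ → r) × b) ((μ → r) × b) ℂ) = localTest 1 j := by
    rw [localTest, one_kronecker_one, submatrix_one_equiv]
  rw [this]
  ext p q
  simp only [localTest, submatrix_apply, kroneckerMap_apply, Matrix.sub_apply, sub_mul]

lemma trace_kronecker_one_mul {α β : Type*} [Fintype α] [Fintype β] [DecidableEq β]
    (T : Matrix α α ℂ) (X : Matrix (α × β) (α × β) ℂ) :
    ((T ⊗ₖ (1 : Matrix β β ℂ)) * X).trace = (T * traceRight X).trace := by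
  simp only [trace, diag_apply, mul_apply, traceRight, of_apply, kroneckerMap_apply,
    Fintype.sum_prod_type, one_apply, mul_ite, mul_one, mul_zero, ite_mul, zero_mul,
    Finset.sum_ite_eq, Finset.mem_univ, if_true, Finset.mul_sum]
  exact Finset.sum_congr rfl fun i _ => Finset.sum_comm

/-- A local test sees only the marginal on its position and the output. -/
lemma trace_localTest_mul (T : Matrix (r × b) (r × b) ℂ) (j : μ)
    (X : Matrix ((μ → r) × b) ((μ → r) × b) ℂ) :
    (localTest T j * X).trace =
      (T * traceRight (X.submatrix (splitEquiv j r b).symm (splitEquiv j r b).symm)).trace := by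
  rw [← trace_kronecker_one_mul, ← trace_submatrix_equiv (_ * X) (splitEquiv j r b).symm,
    ← submatrix_mul_equiv _ _ _ (splitEquiv j r b).symm]
  congr 2
  rw [localTest, submatrix_submatrix, Equiv.self_comp_symm, submatrix_id_id]

/-- With the output indices frozen as parameters, the state is a product over positions, to which
`sum_prod_piSplitAt` applies. -/
lemma outState_apply (ω : Matrix (r × b) (r × b) ℂ) (m : μ) (p q : (μ → r) × b) :
    outState ω m p q = ∏ i, (if i = m then Matrix.of fun x x' => ω (x, p.2) (x', q.2)
      else traceRight ω) (p.1 i) (q.1 i) := by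
  rw [prod_eq_mul_prod_ne m, outState, submatrix_apply, kroneckerMap_apply]
  simp only [if_true]
  refine congrArg₂ _ rfl ?_
  rw [piKron, of_apply]
  refine Finset.prod_congr rfl fun i _ => ?_
  rw [if_neg i.2]
  rfl

lemma traceRight_outState_same {ω : Matrix (r × b) (r × b) ℂ} (hω : (traceRight ω).trace = 1)
    (m : μ) : traceRight ((outState ω m).submatrix (splitEquiv m r b).symm
      (splitEquiv m r b).symm) = ω := by
  ext p q
  simp only [traceRight, of_apply, submatrix_apply, outState_apply]
  refine (sum_prod_piSplitAt m (fun i => if i = m then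
    Matrix.of fun x x' => ω (x, p.2) (x', q.2) else traceRight ω) p.1 q.1).trans ?_
  rw [Finset.prod_eq_one, mul_one]
  · simp
  · intro i _
    rw [if_neg i.2, hω]

lemma traceRight_outState_of_ne {ω : Matrix (r × b) (r × b) ℂ} (hω : (traceRight ω).trace = 1)
    {m j : μ} (hj : j ≠ m) : traceRight ((outState ω m).submatrix (splitEquiv j r b).symm
      (splitEquiv j r b).symm) = traceRight ω ⊗ₖ traceLeft ω := by
  ext p q
  rw [kroneckerMap_apply]
  conv_lhs => rw [traceRight, of_apply]
  simp only [submatrix_apply, outState_apply]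
  refine (sum_prod_piSplitAt j (fun i => if i = m then
    Matrix.of fun x x' => ω (x, p.2) (x', q.2) else traceRight ω) p.1 q.1).trans ?_
  rw [if_neg hj]
  congr 1
  -- Of the traced-out positions only `m` contributes a factor other than 1: tracing R out of ω
  -- there leaves an entry of ω_B.
  rw [Fintype.prod_eq_single (⟨m, hj.symm⟩ : {i // i ≠ j})]
  · simp [trace, traceLeft]
  · intro i hi
    rw [if_neg (fun h => hi (Subtype.ext h)), hω]

/-- The one-shot error bound of position-based coding with a given binary test. -/
lemma hasCode_positionBased (N : Matrix a a ℂ →ₗ[ℂ] Matrix b b ℂ) {θ : Matrix (r × a) (r × a) ℂ}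
    (hθ : IsDensity θ) (h : traceRight (idTensor N θ) = traceRight θ) (hω : 0 ≤ idTensor N θ)
    {T : Matrix (r × b) (r × b) ℂ} (hT0 : 0 ≤ T) (hT1 : T ≤ 1) {M : ℕ} (hM : 0 < M) :
    HasCode N M (2 * (idTensor N θ * (1 - T)).trace.re + 4 * (((M : ℝ) - 1) *
      ((traceRight (idTensor N θ) ⊗ₖ traceLeft (idTensor N θ)) * T).trace.re)) := by
  set ω := idTensor N θ with hωdef
  have : Nonempty (Fin M) := ⟨⟨0, hM⟩⟩
  have htr : (traceRight ω).trace = 1 := by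
    rw [h, ← hθ.2]
    simp [trace, traceRight, Fintype.sum_prod_type]
  obtain ⟨Λ, hΛ0, hΛ1, hΛ⟩ := exists_povm (fun m : Fin M => localTest T m)
    (fun m => localTest_nonneg hT0 m) (fun m => by
      rw [← sub_nonneg, one_sub_localTest]
      exact localTest_nonneg (sub_nonneg.mpr hT1) m)
  refine HasCode.of_fintype (Ψ := zipPow (Fin M) θ) (E := fun m => marginal a m) (Λ := Λ)
    ⟨nonneg_iff_posSemidef.mp (zipPow_nonneg (nonneg_iff_posSemidef.mpr hθ.1)), ?_⟩
    (fun m => isChannel_marginal m) hΛ0 hΛ1 ?_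
  · rw [trace_zipPow, hθ.2, one_pow]
  simp_rw [idTensor_marginal N h, ← hωdef]
  have bound : ∀ m : Fin M, ((1 - Λ m) * outState ω m).trace.re ≤
      2 * (ω * (1 - T)).trace.re +
        4 * (((M : ℝ) - 1) * ((traceRight ω ⊗ₖ traceLeft ω) * T).trace.re) := by
    intro m
    refine (re_trace_mul_mono_left (outState_nonneg hω m) (hΛ m)).trans (le_of_eq ?_)
    have e : ∑ j, localTest T j - localTest T m = ∑ j ∈ Finset.univ.erase m, localTest T j := by
      rw [← Finset.add_sum_erase _ _ (Finset.mem_univ m), add_sub_cancel_left]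
    rw [e, one_sub_localTest, Matrix.add_mul, Matrix.smul_mul, Matrix.smul_mul, Finset.sum_mul,
      trace_add, trace_smul, trace_smul, trace_sum, trace_localTest_mul,
      traceRight_outState_same htr,
      Finset.sum_congr rfl (g := fun _ => (T * (traceRight ω ⊗ₖ traceLeft ω)).trace)]
    · rw [Finset.sum_const, Finset.card_erase_of_mem (Finset.mem_univ m), Finset.card_univ,
        Fintype.card_fin, Matrix.trace_mul_comm ω, Matrix.trace_mul_comm _ T]
      simp [Nat.cast_sub (Nat.one_le_iff_ne_zero.mpr hM.ne')]
    · intro j hj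
      rw [trace_localTest_mul, traceRight_outState_of_ne htr (Finset.ne_of_mem_erase hj)]
  have hM' : (0 : ℝ) < M := by exact_mod_cast hM
  calc _ ≤ 1 / (M : ℝ) * ∑ _m : Fin M, (2 * (ω * (1 - T)).trace.re +
        4 * (((M : ℝ) - 1) * ((traceRight ω ⊗ₖ traceLeft ω) * T).trace.re)) := by
        gcongr with m
        exact bound m
    _ = _ := by
        rw [Finset.sum_const, Finset.card_univ, Fintype.card_fin, nsmul_eq_mul]
        field_simp

/-- The one-shot error bound in terms of the Rényi trace. -/
lemma hasCode_renyi (N : Matrix a a ℂ →ₗ[ℂ] Matrix b b ℂ) {θ : Matrix (r × a) (r × a) ℂ}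
    (hθ : IsDensity θ) (h : traceRight (idTensor N θ) = traceRight θ) (hω : 0 ≤ idTensor N θ)
    {s : ℝ} (hs : 0 ≤ s) (hs1 : s < 1) {M : ℕ} (hM : 0 < M) {c : ℝ} (hc : 0 < c)
    (hMc : (M : ℝ) - 1 ≤ c) :
    HasCode N M (4 * (c ^ (1 - s) * renyiTrace s (idTensor N θ)
      (traceRight (idTensor N θ) ⊗ₖ traceLeft (idTensor N θ)))) := by
  set ω := idTensor N θ with hωdef
  set σ := traceRight ω ⊗ₖ traceLeft ω with hσ
  have hσ0 : 0 ≤ σ := kronecker_nonneg (traceRight_nonneg hω) (traceLeft_nonneg hω)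
  have hcσ : 0 ≤ (c : ℂ) • σ := by
    refine nonneg_iff_posSemidef.mpr ((nonneg_iff_posSemidef.mp hσ0).smul ?_)
    exact_mod_cast hc.le
  -- The weight c makes the test balance one missed detection against at most c false alarms; the
  -- factors 2 and 4 are both bounded by 4.
  obtain ⟨T, hT0, hT1, hT⟩ := exists_test hω hcσ hs hs1
  obtain ⟨dR, dA, Ψ, E, Λ, h1, h2, h3, h4, h5⟩ := hasCode_positionBased N hθ h hω hT0 hT1 hM
  refine ⟨dR, dA, Ψ, E, Λ, h1, h2, h3, h4, h5.trans ?_⟩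
  have e1 : renyiTrace s ω ((c : ℂ) • σ) = c ^ (1 - s) * renyiTrace s ω σ := by
    rw [renyiTrace, suppPow_smul hσ0 hc, Matrix.mul_smul, trace_smul, smul_eq_mul,
      Complex.re_ofReal_mul, renyiTrace]
  have e2 : (((c : ℂ) • σ) * T).trace.re = c * (σ * T).trace.re := by
    rw [Matrix.smul_mul, trace_smul, smul_eq_mul, Complex.re_ofReal_mul]
  rw [e1, e2] at hT
  have n1 := re_trace_mul_nonneg hω (sub_nonneg.mpr hT1)
  have n2 := mul_le_mul_of_nonneg_right hMc (re_trace_mul_nonneg hσ0 hT0)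
  rw [← hωdef, ← hσ]
  linarith

end PositionBasedCoding
-- Asymptotics of the error bound.
section ErrorExponent
set_option linter.unusedSectionVars false
open Matrix Filter Topology
open scoped MatrixOrder Matrix.Norms.L2Operator

variable {r a b : Type*} [Fintype r] [DecidableEq r] [Fintype a] [DecidableEq a] [Fintype b]
  [DecidableEq b]

lemma bddBelow_errors (N : Matrix a a ℂ →ₗ[ℂ] Matrix b b ℂ) (M : ℕ) :
    BddBelow {ε : ℝ | 0 ≤ ε ∧ ε ≤ 1 ∧ HasCode N M ε} := ⟨0, fun _ h => h.1⟩

lemma optError_nonneg (N : Matrix a a ℂ →ₗ[ℂ] Matrix b b ℂ) (M : ℕ) : 0 ≤ optError N M :=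
  Real.sInf_nonneg fun _ h => h.1

lemma optError_le_one (N : Matrix a a ℂ →ₗ[ℂ] Matrix b b ℂ) (M : ℕ) : optError N M ≤ 1 := by
  -- An empty set of errors has `sInf` equal to 0, so the bound holds without exhibiting a code.
  rcases Set.eq_empty_or_nonempty {ε : ℝ | 0 ≤ ε ∧ ε ≤ 1 ∧ HasCode N M ε} with h | ⟨ε, h⟩
  · rw [optError, h, Real.sInf_empty]; exact zero_le_one
  · exact (csInf_le (bddBelow_errors N M) h).trans h.2.1

lemma HasCode.optError_le {N : Matrix a a ℂ →ₗ[ℂ] Matrix b b ℂ} {M : ℕ} {K : ℝ}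
    (h : HasCode N M K) (hK : 0 ≤ K) : optError N M ≤ K := by
  rcases le_total K 1 with h1 | h1
  · exact csInf_le (bddBelow_errors N M) ⟨hK, h1, h⟩
  · exact (optError_le_one N M).trans h1

lemma negLog2_anti {x y : ℝ} (hx : 0 ≤ x) (h : x ≤ y) : negLog2 y ≤ negLog2 x := by
  rcases hx.eq_or_lt with rfl | hx
  · simp [negLog2]
  · rw [negLog2, negLog2, if_neg hx.ne', if_neg (hx.trans_le h).ne']
    exact_mod_cast neg_le_neg (Real.logb_le_logb_of_le one_lt_two hx h)

lemma negLog2_nonneg {x : ℝ} (hx : 0 ≤ x) (h : x ≤ 1) : 0 ≤ negLog2 x := by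
  refine le_trans ?_ (negLog2_anti hx h)
  simp [negLog2]

/-- Settles s = 1 in the theorem and excludes the value -∞. -/
lemma errorExponent_nonneg (N : Matrix a a ℂ →ₗ[ℂ] Matrix b b ℂ) (R : ℝ) :
    0 ≤ errorExponent N R := by
  refine le_limsup_of_frequently_le (Eventually.frequently (Eventually.of_forall fun n => ?_))
  refine mul_nonneg ?_ (negLog2_nonneg (optError_nonneg _ _) (optError_le_one _ _))
  exact_mod_cast (by positivity : (0 : ℝ) ≤ 1 / (n : ℝ))

lemma isDensity_ketbra {ψ : a → ℂ} (h : ∑ i, ‖ψ i‖ ^ 2 = 1) : IsDensity (ketbra ψ) := by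
  refine ⟨posSemidef_vecMulVec_self_star ψ, ?_⟩
  have : ∀ i, ψ i * star (ψ i) = ((‖ψ i‖ ^ 2 : ℝ) : ℂ) := fun i => by
    rw [Complex.star_def, Complex.mul_conj, Complex.normSq_eq_norm_sq]
  simp only [trace, diag_apply, ketbra, vecMulVec_apply, Pi.star_apply, this]
  rw [← Complex.ofReal_sum, h, Complex.ofReal_one]

lemma IsChannel.traceRight_idTensor {N : Matrix a a ℂ →ₗ[ℂ] Matrix b b ℂ} (hN : IsChannel N)
    (X : Matrix (r × a) (r × a) ℂ) : traceRight (idTensor N X) = traceRight X := by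
  ext i j
  exact hN.trace_preserving (Matrix.of fun k l => X (i, k) (j, l))

/-- The error bound for `n` uses of the channel. -/
lemma optError_tensorPow_le {N : Matrix a a ℂ →ₗ[ℂ] Matrix b b ℂ} {θ : Matrix (r × a) (r × a) ℂ}
    (hθ : IsDensity θ) (h : traceRight (idTensor N θ) = traceRight θ) (hω : 0 ≤ idTensor N θ)
    {s : ℝ} (hs : 0 ≤ s) (hs1 : s < 1) (R : ℝ) (n : ℕ) :
    optError (tensorPow N n) ⌈(2 : ℝ) ^ ((n : ℝ) * R)⌉₊ ≤
      4 * (((2 : ℝ) ^ ((n : ℝ) * R)) ^ (1 - s) * renyiTrace s (idTensor N θ)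
        (traceRight (idTensor N θ) ⊗ₖ traceLeft (idTensor N θ)) ^ n) := by
  have hσ := kronecker_nonneg (traceRight_nonneg hω) (traceLeft_nonneg hω)
  have hc : (0 : ℝ) < 2 ^ ((n : ℝ) * R) := by positivity
  have hn : IsDensity (zipPow (Fin n) θ) :=
    ⟨nonneg_iff_posSemidef.mp (zipPow_nonneg (nonneg_iff_posSemidef.mpr hθ.1)), by
      rw [trace_zipPow, hθ.2, one_pow]⟩
  have key := hasCode_renyi (tensorPow N n) hn
    (by rw [idTensor_tensorPow, traceRight_zipPow, traceRight_zipPow, h])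
    (by rw [idTensor_tensorPow]; exact zipPow_nonneg hω) hs hs1 (Nat.ceil_pos.mpr hc) hc
    -- Only M - 1 wrong positions count, so the ceiling costs nothing: ⌈x⌉ - 1 ≤ x.
    (by linarith [Nat.ceil_lt_add_one hc.le])
  rw [idTensor_tensorPow, traceRight_zipPow, traceLeft_zipPow, ← zipPow_kronecker,
    renyiTrace_zipPow hω hσ, Fintype.card_fin] at key
  have := renyiTrace_nonneg hω hσ s
  exact key.optError_le (by positivity)

/-- The exponent bound solved for I_s under a finite exponent: the right side is a real number
independent of θ, so the supremum over states can be taken with no arithmetic on infinities. -/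
lemma renyiMI_le_of_errorExponent_le {N : Matrix a a ℂ →ₗ[ℂ] Matrix b b ℂ}
    {θ : Matrix (r × a) (r × a) ℂ} (hθ : IsDensity θ)
    (h : traceRight (idTensor N θ) = traceRight θ) (hω : 0 ≤ idTensor N θ)
    {s : ℝ} (hs : 0 ≤ s) (hs1 : s < 1) {R e : ℝ} (he : errorExponent N R ≤ (e : EReal)) :
    renyiMI s (idTensor N θ) ≤ ((e / (1 - s) + R : ℝ) : EReal) := by
  have hσ := kronecker_nonneg (traceRight_nonneg hω) (traceLeft_nonneg hω)
  have hle := optError_tensorPow_le hθ h hω hs hs1 R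
  rw [renyiMI, renyiDiv, if_neg hs1.ne]
  have ht0 := renyiTrace_nonneg hω hσ s
  set t := renyiTrace s (idTensor N θ) (traceRight (idTensor N θ) ⊗ₖ traceLeft (idTensor N θ))
  rcases ht0.eq_or_lt with ht | ht
  · exfalso
    -- A vanishing Rényi trace makes the error 0 for every n > 0, which contradicts a finite
    -- exponent.
    have : (⊤ : EReal) ≤ errorExponent N R := by
      refine le_limsup_of_frequently_le (Eventually.frequently ?_)
      filter_upwards [eventually_gt_atTop 0] with n hn
      have h0 : optError (tensorPow N n) ⌈(2 : ℝ) ^ ((n : ℝ) * R)⌉₊ = 0 := by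
        refine le_antisymm ((hle n).trans ?_) (optError_nonneg _ _)
        rw [← ht, zero_pow hn.ne']; simp
      rw [h0, negLog2, if_pos rfl, EReal.coe_mul_top_of_pos (by positivity)]
    exact absurd (this.trans he) (by simp)
  · have hif : ¬ ((1 < s ∧ ¬ SuppLE (idTensor N θ)
        (traceRight (idTensor N θ) ⊗ₖ traceLeft (idTensor N θ))) ∨ (s < 1 ∧ t = 0)) := by
      rintro (⟨h1, -⟩ | ⟨-, h2⟩)
      · linarith
      · exact ht.ne' h2
    rw [if_neg hif, EReal.coe_le_coe_iff]
    -- This is -1/n log₂ of the error bound; the term 2/n comes from the prefactor 4 and disappears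
    -- in the limit.
    let v : ℕ → ℝ := fun n => -(2 * (1 / (n : ℝ))) + (-((1 - s) * R) - Real.logb 2 t)
    have hv : Tendsto v atTop (𝓝 (-((1 - s) * R) - Real.logb 2 t)) := by
      have := ((tendsto_one_div_atTop_nhds_zero_nat (𝕜 := ℝ)).const_mul 2).neg.add_const
        (-((1 - s) * R) - Real.logb 2 t)
      simpa [v] using this
    have hL : ((-((1 - s) * R) - Real.logb 2 t : ℝ) : EReal) ≤ errorExponent N R := by
      rw [← ((continuous_coe_real_ereal.tendsto _).comp hv).limsup_eq]
      refine limsup_le_limsup ?_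
      filter_upwards [eventually_gt_atTop 0] with n hn
      have hn' : (0 : ℝ) < n := by exact_mod_cast hn
      refine le_trans ?_ (mul_le_mul_of_nonneg_left (negLog2_anti (optError_nonneg _ _) (hle n)) ?_)
      · rw [negLog2, if_neg (by positivity), ← EReal.coe_mul, Function.comp_apply,
          EReal.coe_le_coe_iff]
        refine le_of_eq ?_
        rw [Real.logb_mul (by norm_num) (by positivity), Real.logb_mul (by positivity)
          (by positivity), Real.logb_pow, ← Real.rpow_mul (by norm_num), Real.logb_rpow
          (by norm_num) (by norm_num)]
        have : Real.logb 2 4 = 2 := by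
          rw [show (4 : ℝ) = 2 ^ (2 : ℝ) by norm_num, Real.logb_rpow (by norm_num) (by norm_num)]
        rw [this]
        simp only [v]
        field_simp
        ring
      · exact_mod_cast (by positivity : (0 : ℝ) ≤ 1 / (n : ℝ))
    have hfin : -((1 - s) * R) - Real.logb 2 t ≤ e := by exact_mod_cast hL.trans he
    have hs' : 0 < 1 - s := by linarith
    have e1 : 1 / (s - 1) * Real.logb 2 t = -Real.logb 2 t / (1 - s) := by
      rw [← neg_sub 1 s]; field_simp
    rw [e1, ← sub_le_iff_le_add, div_sub' hs'.ne']
    exact div_le_div_of_nonneg_right (by linarith) hs'.le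

end ErrorExponent
end EACode

theorem mainTheorem10 {a b : Type*} [Fintype a] [DecidableEq a] [Nonempty a]
    [Fintype b] [DecidableEq b] (N : Matrix a a ℂ →ₗ[ℂ] Matrix b b ℂ)
    (hN : EACode.IsChannel N) (R : ℝ) (hR : 0 ≤ R) :
    (⨆ s ∈ Set.Icc (0 : ℝ) 1,
        ((1 - s : ℝ) : EReal) * (EACode.channelRenyiMI N s - (R : EReal))) ≤
      EACode.errorExponent N R := by
  refine iSup₂_le fun s hs => ?_
  have h0 := EACode.errorExponent_nonneg N R
  rcases hs.2.eq_or_lt with rfl | hs1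
  -- The factor 1 - s is 0, and in `EReal` 0 times anything is 0, even if the supremum is infinite.
  · simpa using h0
  have hs' : 0 < 1 - s := by linarith
  induction hE : EACode.errorExponent N R using EReal.rec with
  | bot => rw [hE] at h0; simp at h0
  | top => exact le_top
  | coe e =>
    have hI : EACode.channelRenyiMI N s ≤ ((e / (1 - s) + R : ℝ) : EReal) :=
      iSup_le fun k => iSup_le fun ψ => iSup_le fun hψ =>
        have hθ := EACode.isDensity_ketbra hψ
        EACode.renyiMI_le_of_errorExponent_le hθ (hN.traceRight_idTensor _)
          (Matrix.nonneg_iff_posSemidef.mpr (hN.completely_positive k _ hθ.1)) hs.1 hs1 hE.le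
    calc _ ≤ ((1 - s : ℝ) : EReal) * (((e / (1 - s) + R : ℝ) : EReal) - (R : EReal)) :=
          mul_le_mul_of_nonneg_left (EReal.sub_le_sub hI le_rfl) (by exact_mod_cast hs'.le)
      _ = (e : EReal) := by
          rw [← EReal.coe_sub, ← EReal.coe_mul]
          congr 1
          field_simp
          ring
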